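/- Let $d\ge 1$, $n\ge 2$, $1\le k\le\lfloor n/2\rfloor$ and $m$ be integers, $A_*\in\mathbb R^{d\times d}$, $R\in\mathbb R^{d^2\times m}$ of full column rank $m$, $\sigma>0$, $\delta\in(0,1)$, and let $C_0,C_1>0$ be fixed constants. Let $X_0=0$ and $X_{t+1}=A_*X_t+\eta_t$ for $t\ge 0$, where $\eta_0,\eta_1,\dots$ are i.i.d. random vectors in $\mathbb R^d$ with $E(\eta_t)=0$ and $\mathrm{var}(\eta_t)=\sigma^2I_d$, and let $\Sigma_X$ be the $dn\times dn$ covariance matrix of $(X_1^{\mathsf T},\dots,X_n^{\mathsf T})^{\mathsf T}$. Put $\Gamma_t=\sum_{s=0}^{t-1}A_*^s(A_*^{\mathsf T})^s$, $\psi=C_1\{m\log 9+\log d+\log(2/\delta)\}$, $$\xi=2\left\{\frac{\lambda_{\max}(\Gamma_n)\,\psi\,\|\Sigma_X\|_2}{\sigma^2n}\right\}^{1/2}+\frac{2\psi\|\Sigma_X\|_2}{\sigma^2n},\qquad \underline\Gamma_R=\frac{\sigma^2R^{\mathsf T}(I_d\otimes\Gamma_k)R}{(4C_0)^2},$$ $$\overline\Gamma^{(1)}_R=\frac{\sigma^2m\,R^{\mathsf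 T}(I_d\otimes\Gamma_n)R}{\delta},\qquad \overline\Gamma^{(2)}_R=\sigma^2R^{\mathsf T}(I_d\otimes\Gamma_n)R+\sigma^2\xi\,R^{\mathsf T}R .$$ Here $\rho(\cdot)$ is the spectral radius and $\|\cdot\|_2$ the spectral norm. (i) Let $c>0$. There is a constant $K>0$ depending only on $(C_0,C_1,c)$ such that, whenever $\rho(A_*)\le 1+c/n$, and for every Jordan decomposition $A_*=SJS^{-1}$ over $\mathbb C$ (ones on the superdiagonal of the Jordan blocks), with largest block size $b_{\max}$ and $\mathrm{cond}(S)=\{\lambda_{\max}(S^*S)/\lambda_{\min}(S^*S)\}^{1/2}$, $$\log\det(\overline\Gamma_R\underline\Gamma_R^{-1})\le K\,m\left[\log\{d\,\mathrm{cond}(S)/\delta\}+b_{\max}\log n\right]\quad\text{for }\overline\Gamma_R=\overline\Gamma^{(1)}_R\text{ and for }\overline\Gamma_R=\overline\Gamma^{(2)}_R .$$ (ii) Let $0<\bar\rho<1$, $C>0$ and $\tau>1$. Whenever $\rho(A_*)\le\bar\rho$, $\|A_*\|_2\le C$ and $m/\delta\ge\tau$, $$\log\det(\overline\Gamma^{(1)}_R\underline\Gamma_R^{-1})\le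 K\,m\log(m/\delta),$$ where the constant $K>0$ depends only on $(C_0,\bar\rho,C,\tau)$ and, as regards $A_*$, on $n_0(A_*)$ alone, the least integer $n_0$ such that $\|A_*^s\|_2\le\{(1+\bar\rho)/2\}^s$ for all $s\ge n_0$ (finite for every such $A_*$, by Gelfand's formula). In particular, $K$ does not depend on $(n,d,m,R,k,\sigma,\delta)$. (iii) Let $0<\bar\rho<1$, $0<\varrho<1$ and $\mu_1,C,c'>0$. There is a constant $K>0$ depending only on $(C_0,C_1,\bar\rho,\mu_1,C,\varrho,c')$ such that, whenever $\rho(A_*)\le\bar\rho$, $\inf_{|z|=1}\lambda_{\min}\{(I_d-A_*z)^*(I_d-A_*z)\}\ge\mu_1$, $\|A_*^t\|_2\le C\varrho^t$ for all integers $1\le t\le n$, and $n\ge c'\{m+\log(d/\delta)\}$, $$\log\det(\overline\Gamma^{(2)}_R\underline\Gamma_R^{-1})\le K\,m .$$ -/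

import Mathlib

open scoped Kronecker
open MeasureTheory ProbabilityTheory

universe u

noncomputable section

namespace LinearVAR

/-! ### Spectral quantities of matrices -/

section Spectral

variable {ι : Type*} [Fintype ι] [DecidableEq ι]

/-- The largest real eigenvalue of a matrix over `𝕜 = ℝ` or `ℂ`; it is used for Hermitian matrices,
all of whose eigenvalues are real. -/
def lamMax {𝕜 : Type*} [RCLike 𝕜] (M : Matrix ι ι 𝕜) : ℝ := sSup (spectrum ℝ M)

/-- The smallest real eigenvalue of a matrix over `𝕜 = ℝ` or `ℂ`; it is used for Hermitian
matrices, all of whose eigenvalues are real. -/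
def lamMin {𝕜 : Type*} [RCLike 𝕜] (M : Matrix ι ι 𝕜) : ℝ := sInf (spectrum ℝ M)

/-- The spectral norm `‖M‖₂`, i.e. the operator norm for the Euclidean norm. -/
def specNorm (M : Matrix ι ι ℝ) : ℝ := ‖Matrix.toEuclideanCLM (n := ι) (𝕜 := ℝ) M‖

/-- A real matrix, seen as a complex matrix. -/
def cplx (M : Matrix ι ι ℝ) : Matrix ι ι ℂ := M.map (algebraMap ℝ ℂ)

/-- The spectral radius `ρ(M)`: the largest modulus of a complex eigenvalue of the real
matrix `M`. -/
def specRad (M : Matrix ι ι ℝ) : ℝ := (spectralRadius ℂ (cplx M)).toReal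

/-- The condition number `{λ_max(S^* S) / λ_min(S^* S)}^{1/2}`. -/
def condNum (S : Matrix ι ι ℂ) : ℝ :=
  Real.sqrt (lamMax (S.conjTranspose * S) / lamMin (S.conjTranspose * S))

/-- `μ_min(𝒜) = inf_{|z| = 1} λ_min(𝒜(z)^* 𝒜(z))`, where `𝒜(z) = I - A z`. -/
def muMin (A : Matrix ι ι ℝ) : ℝ :=
  ⨅ z : Circle, lamMin ((1 - (z : ℂ) • cplx A).conjTranspose * (1 - (z : ℂ) • cplx A))

/-- The least `N` such that `‖A ^ s‖₂ ≤ ((1 + r) / 2) ^ s` for all `s ≥ N`. By Gelfand's formula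
such an `N` exists whenever `ρ(A) ≤ r < 1`. -/
def decayIndex (r : ℝ) (A : Matrix ι ι ℝ) : ℕ :=
  sInf {N : ℕ | ∀ s : ℕ, N ≤ s → specNorm (A ^ s) ≤ ((1 + r) / 2) ^ s}

end Spectral

/-! ### Jordan decompositions -/

/-- The `b × b` Jordan block with eigenvalue `z`, with ones on the superdiagonal. -/
def jordanBlock (b : ℕ) (z : ℂ) : Matrix (Fin b) (Fin b) ℂ :=
  Matrix.of fun i j => if i = j then z else if (i : ℕ) + 1 = (j : ℕ) then 1 else 0

/-- The block diagonal `d × d` matrix whose diagonal blocks are, in this order, the Jordan blocks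
of size `b ℓ` with eigenvalue `eig ℓ`. -/
def jordanMatrix {d L : ℕ} (b : Fin L → ℕ) (hb : ∑ l, b l = d) (eig : Fin L → ℂ) :
    Matrix (Fin d) (Fin d) ℂ :=
  Matrix.reindex (finSigmaFinEquiv.trans (finCongr hb)) (finSigmaFinEquiv.trans (finCongr hb))
    (Matrix.blockDiagonal' fun l => jordanBlock (b l) (eig l))

/-- A Jordan decomposition `A = S J S⁻¹` over `ℂ` of a real square matrix. -/
structure JordanDecomposition {d : ℕ} (A : Matrix (Fin d) (Fin d) ℝ) where
  /-- the number of blocks -/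
  L : ℕ
  /-- the sizes of the blocks -/
  b : Fin L → ℕ
  one_le_b : ∀ l, 1 ≤ b l
  sum_b : ∑ l, b l = d
  /-- the eigenvalues of the blocks -/
  eig : Fin L → ℂ
  /-- the similarity matrix -/
  S : Matrix (Fin d) (Fin d) ℂ
  isUnit_S : IsUnit S
  eq_conj : cplx A = S * jordanMatrix b sum_b eig * S⁻¹

/-- The size of the largest Jordan block. -/
def JordanDecomposition.bMax {d : ℕ} {A : Matrix (Fin d) (Fin d) ℝ}
    (D : JordanDecomposition A) : ℕ := Finset.univ.sup D.b

/-! ### The vector autoregressive process -/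

/-- The innovations `η_0, η_1, …` are independent and identically distributed random vectors in
`ℝ^d` with finite second moments, mean zero and covariance matrix `σ² I_d`. -/
structure IsInnovation {Ω : Type u} [MeasurableSpace Ω] (P : Measure Ω) {d : ℕ} (σ : ℝ)
    (η : ℕ → Ω → (Fin d → ℝ)) : Prop where
  indep : iIndepFun η P
  identDistrib : ∀ t, IdentDistrib (η t) (η 0) P P
  memLp : ∀ t i, MemLp (fun ω => η t ω i) 2 P
  mean : ∀ t i, ∫ ω, η t ω i ∂P = 0
  cov : ∀ t i j, covariance (fun ω => η t ω i) (fun ω => η t ω j) P = if i = j then σ ^ 2 else 0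

/-- The process `X_0 = 0`, `X_{t+1} = A X_t + η_t`. -/
def process {Ω : Type u} {d : ℕ} (A : Matrix (Fin d) (Fin d) ℝ) (η : ℕ → Ω → (Fin d → ℝ)) :
    ℕ → Ω → (Fin d → ℝ)
  | 0 => fun _ => 0
  | t + 1 => fun ω => A.mulVec (process A η t ω) + η t ω

/-- The covariance matrix `Σ_X` of the vector `(X_1ᵀ, …, X_nᵀ)ᵀ` of length `d n`; the index
`(t, i)` stands for the `i`th entry of `X_{t+1}`, where `t = 0, …, n - 1`. -/
def sigmaX {Ω : Type u} [MeasurableSpace Ω] (P : Measure Ω) {d : ℕ} (n : ℕ)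
    (A : Matrix (Fin d) (Fin d) ℝ) (η : ℕ → Ω → (Fin d → ℝ)) :
    Matrix (Fin n × Fin d) (Fin n × Fin d) ℝ :=
  Matrix.of fun p q =>
    covariance (fun ω => process A η (p.1 + 1) ω p.2) (fun ω => process A η (q.1 + 1) ω q.2) P

/-! ### The lower and upper matrices -/

/-- The finite-time controllability Gramian `Γ_t = ∑_{s=0}^{t-1} A^s (Aᵀ)^s`. -/
def gramian {d : ℕ} (A : Matrix (Fin d) (Fin d) ℝ) (t : ℕ) : Matrix (Fin d) (Fin d) ℝ :=
  ∑ s ∈ Finset.range t, A ^ s * A.transpose ^ s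

/-- `ψ(m, d, δ) = C₁ {m log 9 + log d + log (2 / δ)}`. -/
def psi (C₁ : ℝ) (m d : ℕ) (δ : ℝ) : ℝ :=
  C₁ * (m * Real.log 9 + Real.log d + Real.log (2 / δ))

/-- `ξ(m, d, n, δ) = 2 {λ_max(Γ_n) ψ ‖Σ_X‖₂ / (σ² n)}^{1/2} + 2 ψ ‖Σ_X‖₂ / (σ² n)`. -/
def xi {Ω : Type u} [MeasurableSpace Ω] (P : Measure Ω) {d : ℕ} (C₁ : ℝ) (m n : ℕ)
    (A : Matrix (Fin d) (Fin d) ℝ) (η : ℕ → Ω → (Fin d → ℝ)) (σ δ : ℝ) : ℝ :=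
  2 * Real.sqrt (lamMax (gramian A n) * psi C₁ m d δ * specNorm (sigmaX P n A η) / (σ ^ 2 * n))
    + 2 * psi C₁ m d δ * specNorm (sigmaX P n A η) / (σ ^ 2 * n)

/-- `Rᵀ (I_d ⊗ Γ) R`, where the rows of the `d² × m` matrix `R` are indexed by pairs
(index of the `d × m` block `R_i`, row within `R_i`). -/
def restrict {d m : ℕ} (R : Matrix (Fin d × Fin d) (Fin m) ℝ) (Γ : Matrix (Fin d) (Fin d) ℝ) :
    Matrix (Fin m) (Fin m) ℝ :=
  R.transpose * ((1 : Matrix (Fin d) (Fin d) ℝ) ⊗ₖ Γ) * R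

/-- The lower matrix `σ² Rᵀ (I_d ⊗ Γ_k) R / (4 C₀)²`. -/
def gammaLower {d m : ℕ} (C₀ : ℝ) (k : ℕ) (A : Matrix (Fin d) (Fin d) ℝ)
    (R : Matrix (Fin d × Fin d) (Fin m) ℝ) (σ : ℝ) : Matrix (Fin m) (Fin m) ℝ :=
  (σ ^ 2 / (4 * C₀) ^ 2) • restrict R (gramian A k)

/-- The first upper matrix `σ² m Rᵀ (I_d ⊗ Γ_n) R / δ`. -/
def gammaUpper₁ {d m : ℕ} (n : ℕ) (A : Matrix (Fin d) (Fin d) ℝ)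
    (R : Matrix (Fin d × Fin d) (Fin m) ℝ) (σ δ : ℝ) : Matrix (Fin m) (Fin m) ℝ :=
  (σ ^ 2 * m / δ) • restrict R (gramian A n)

/-- The second upper matrix `σ² Rᵀ (I_d ⊗ Γ_n) R + σ² ξ(m, d, n, δ) Rᵀ R`. -/
def gammaUpper₂ {Ω : Type u} [MeasurableSpace Ω] (P : Measure Ω) {d m : ℕ} (C₁ : ℝ) (n : ℕ)
    (A : Matrix (Fin d) (Fin d) ℝ) (η : ℕ → Ω → (Fin d → ℝ))
    (R : Matrix (Fin d × Fin d) (Fin m) ℝ) (σ δ : ℝ) : Matrix (Fin m) (Fin m) ℝ :=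
  σ ^ 2 • restrict R (gramian A n) + (σ ^ 2 * xi P C₁ m n A η σ δ) • (R.transpose * R)

/-- The standing conditions on `(n, d, m, R, k, σ, δ)`: `d ≥ 1`, `1 ≤ k ≤ ⌊n/2⌋`, the restriction
matrix `R` has full column rank, `σ > 0` and `δ ∈ (0, 1)`. -/
structure IsSetting (n : ℕ) {d m : ℕ} (k : ℕ) (R : Matrix (Fin d × Fin d) (Fin m) ℝ)
    (σ δ : ℝ) : Prop where
  one_le_d : 1 ≤ d
  one_le_k : 1 ≤ k
  k_le : k ≤ n / 2
  rank_R : R.rank = m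
  sigma_pos : 0 < σ
  delta_pos : 0 < δ
  delta_lt_one : δ < 1

end LinearVAR

end

namespace LinearVAR

open scoped Matrix.Norms.L2Operator

open Matrix

section MatrixBounds

variable {ι : Type*} [Fintype ι] [DecidableEq ι]

lemma specNorm_eq_norm (M : Matrix ι ι ℝ) : specNorm M = ‖M‖ := rfl

lemma posSemidef_smul_one_sub_of_norm_le {M : Matrix ι ι ℝ} (hM : M.IsHermitian) {c : ℝ}
    (hc : ‖M‖ ≤ c) : (c • (1 : Matrix ι ι ℝ) - M).PosSemidef := by
  refine PosSemidef.of_dotProduct_mulVec_nonneg ?_ fun x => ?_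
  · exact (isHermitian_one.smul (IsSelfAdjoint.all c)).sub hM
  · have h1 : x ⬝ᵥ (M *ᵥ x) ≤ c * (x ⬝ᵥ x) := by
      have h2 := real_inner_le_norm (WithLp.toLp 2 x) (WithLp.toLp 2 (M *ᵥ x))
      have h3 := l2_opNorm_mulVec M (WithLp.toLp 2 x)
      have h4 : x ⬝ᵥ x = ‖WithLp.toLp 2 x‖ ^ 2 := by
        rw [EuclideanSpace.real_norm_sq_eq]
        simp [dotProduct, sq]
      have h5 : inner ℝ (WithLp.toLp 2 x) (WithLp.toLp 2 (M *ᵥ x)) = x ⬝ᵥ (M *ᵥ x) := by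
        simp [EuclideanSpace.inner_eq_star_dotProduct, dotProduct_comm]
      rw [h5] at h2
      rw [h4]
      have h6 : ‖WithLp.toLp 2 (M *ᵥ x)‖ ≤ ‖M‖ * ‖WithLp.toLp 2 x‖ := h3
      nlinarith [norm_nonneg (WithLp.toLp 2 x), mul_le_mul_of_nonneg_left h6
        (norm_nonneg (WithLp.toLp 2 x)), mul_le_mul_of_nonneg_right hc
        (sq_nonneg ‖WithLp.toLp 2 x‖)]
    simp only [star_trivial, sub_mulVec, smul_mulVec, one_mulVec, dotProduct_sub,
      dotProduct_smul, smul_eq_mul]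
    linarith

lemma exists_eq_transpose_mul_self_of_posDef {L : Matrix ι ι ℝ} (hL : L.PosDef) :
    ∃ B : Matrix ι ι ℝ, IsUnit B.det ∧ L = Bᵀ * B := by
  open scoped MatrixOrder in
  obtain ⟨B, hB⟩ := CStarAlgebra.nonneg_iff_eq_star_mul_self.mp hL.posSemidef.nonneg
  refine ⟨B, ?_, by simpa [star_eq_conjTranspose] using hB⟩
  have h := hL.det_pos
  rw [hB, det_mul] at h
  exact (right_ne_zero_of_mul h.ne').isUnit

lemma eigenvalues_le_of_smul_one_sub {W : Matrix ι ι ℝ} (hW : W.IsHermitian) {c : ℝ}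
    (h : (c • (1 : Matrix ι ι ℝ) - W).PosSemidef) (i : ι) : hW.eigenvalues i ≤ c := by
  have h1 := (posSemidef_iff_isHermitian_and_spectrum_nonneg.mp h).2
  have h2 := hW.eigenvalues_mem_spectrum_real i
  have h3 : c - hW.eigenvalues i ∈ spectrum ℝ (c • (1 : Matrix ι ι ℝ) - W) := by
    rw [← Algebra.algebraMap_eq_smul_one]
    rw [← spectrum.singleton_sub_eq]
    exact Set.sub_mem_sub rfl h2
  have := h1 h3
  simpa using this

/-- If `0 ≤ U ≤ c L` in the Loewner order and `L` is positive definite, then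
`log det (U L⁻¹) ≤ m log c`. -/
lemma log_det_mul_inv_le {L U : Matrix ι ι ℝ} (hL : L.PosDef) (hU : U.PosSemidef) {c : ℝ}
    (hc : 1 ≤ c) (h : (c • L - U).PosSemidef) :
    Real.log (U * L⁻¹).det ≤ Fintype.card ι * Real.log c := by
  obtain ⟨B, hB, rfl⟩ := exists_eq_transpose_mul_self_of_posDef hL
  have hBt : IsUnit Bᵀ.det := by simpa using hB
  set W := (B⁻¹)ᵀ * U * B⁻¹ with hWdef
  have hW : W.PosSemidef := by simpa using hU.conjTranspose_mul_mul_same B⁻¹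
  have hcW : (c • (1 : Matrix ι ι ℝ) - W).PosSemidef := by
    have := h.conjTranspose_mul_mul_same B⁻¹
    convert this using 1
    simp only [conjTranspose_eq_transpose_of_trivial, Matrix.mul_sub, Matrix.sub_mul, hWdef,
      Matrix.mul_smul, Matrix.smul_mul]
    congr 2
    rw [transpose_nonsing_inv, ← mul_assoc, nonsing_inv_mul _ hBt, one_mul, mul_nonsing_inv _ hB]
  have hdet : (U * (Bᵀ * B)⁻¹).det = W.det := by
    rw [hWdef, Matrix.mul_inv_rev, transpose_nonsing_inv]
    simp only [det_mul]
    ring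
  rw [hdet, hW.1.det_eq_prod_eigenvalues]
  have h0 : 0 ≤ ∏ i, hW.1.eigenvalues i := Finset.prod_nonneg fun i _ => hW.eigenvalues_nonneg i
  have h1 : ∏ i, hW.1.eigenvalues i ≤ c ^ Fintype.card ι := by
    rw [← Finset.card_univ, ← Finset.prod_const]
    exact Finset.prod_le_prod (fun i _ => hW.eigenvalues_nonneg i)
      fun i _ => eigenvalues_le_of_smul_one_sub hW.1 hcW i
  simp only [RCLike.ofReal_real_eq_id, id_eq]
  rcases h0.eq_or_lt with h0 | h0
  · rw [← h0, Real.log_zero]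
    exact mul_nonneg (Nat.cast_nonneg _) (Real.log_nonneg hc)
  · rw [← Real.log_pow]
    exact Real.log_le_log h0 h1

end MatrixBounds

section Restrict

variable {d m : ℕ} (R : Matrix (Fin d × Fin d) (Fin m) ℝ)

lemma restrict_posSemidef {Γ : Matrix (Fin d) (Fin d) ℝ} (h : Γ.PosSemidef) :
    (restrict R Γ).PosSemidef := by
  simpa [restrict] using (PosSemidef.one.kronecker h).conjTranspose_mul_mul_same R

lemma restrict_sub (Γ Δ : Matrix (Fin d) (Fin d) ℝ) :
    restrict R (Γ - Δ) = restrict R Γ - restrict R Δ := by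
  have : (1 : Matrix (Fin d) (Fin d) ℝ) ⊗ₖ (Γ - Δ) = 1 ⊗ₖ Γ - 1 ⊗ₖ Δ := by
    ext; simp [mul_sub]
  simp [restrict, this, Matrix.mul_sub, Matrix.sub_mul]

lemma restrict_smul_one (c : ℝ) :
    restrict R (c • (1 : Matrix (Fin d) (Fin d) ℝ)) = c • (Rᵀ * R) := by
  simp [restrict, kronecker_smul]

lemma transpose_mul_self_posDef (hR : R.rank = m) : (Rᵀ * R).PosDef := by
  have := PosDef.conjTranspose_mul_self R (by
    rw [mulVec_injective_iff, linearIndependent_iff_card_eq_finrank_span,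
      Fintype.card_fin, Set.finrank, ← rank_eq_finrank_span_cols, hR])
  simpa using this

lemma gramian_posSemidef (A : Matrix (Fin d) (Fin d) ℝ) (t : ℕ) : (gramian A t).PosSemidef := by
  refine posSemidef_sum _ fun s _ => ?_
  simpa [transpose_pow] using posSemidef_self_mul_conjTranspose (A ^ s)

lemma gramian_sub_one_posSemidef (A : Matrix (Fin d) (Fin d) ℝ) {t : ℕ} (ht : 1 ≤ t) :
    (gramian A t - 1).PosSemidef := by
  obtain ⟨t, rfl⟩ := Nat.exists_eq_add_of_le' ht
  rw [gramian, Finset.sum_range_succ']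
  simp only [pow_zero, mul_one, add_sub_cancel_right]
  refine posSemidef_sum _ fun s _ => ?_
  simpa [transpose_pow] using posSemidef_self_mul_conjTranspose (A ^ (s + 1))

lemma norm_gramian_le (A : Matrix (Fin d) (Fin d) ℝ) (t : ℕ) :
    ‖gramian A t‖ ≤ ∑ s ∈ Finset.range t, ‖A ^ s‖ ^ 2 := by
  refine (norm_sum_le _ _).trans (Finset.sum_le_sum fun s _ => ?_)
  refine (norm_mul_le _ _).trans (le_of_eq ?_)
  rw [← transpose_pow, ← conjTranspose_eq_transpose_of_trivial, l2_opNorm_conjTranspose, sq]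

lemma lamMax_le_norm {ι : Type*} [Fintype ι] [DecidableEq ι] [Nonempty ι] (M : Matrix ι ι ℝ) :
    lamMax M ≤ ‖M‖ :=
  Real.sSup_le (fun _ hx => (le_abs_self _).trans (spectrum.norm_le_norm_of_mem hx))
    (norm_nonneg _)

variable {R}

/-- The common bound behind all three cases: `Γ_k ≥ I` below and `Γ_n ≤ g I` above. -/
lemma log_det_upper_mul_lower_inv_le {n k : ℕ} {σ δ C₀ : ℝ} (hset : IsSetting n k R σ δ)
    (hC₀ : 0 < C₀) {A : Matrix (Fin d) (Fin d) ℝ} {a e g c : ℝ} (ha : 0 ≤ a) (he : 0 ≤ e)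
    (hg : ‖gramian A n‖ ≤ g) (hc : 1 ≤ c) (hcl : a * g + e ≤ σ ^ 2 / (4 * C₀) ^ 2 * c) :
    Real.log ((a • restrict R (gramian A n) + e • (Rᵀ * R)) * (gammaLower C₀ k A R σ)⁻¹).det
      ≤ m * Real.log c := by
  set s := σ ^ 2 / (4 * C₀) ^ 2 with hs
  have hspos : 0 < s := by have := hset.sigma_pos; positivity
  have hRR := transpose_mul_self_posDef R hset.rank_R
  have hlow : (restrict R (gramian A k) - Rᵀ * R).PosSemidef := by
    have h := restrict_posSemidef R (gramian_sub_one_posSemidef A hset.one_le_k)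
    have h1 := restrict_smul_one R 1
    rw [restrict_sub] at h
    rw [one_smul, one_smul] at h1
    rwa [h1] at h
  have hup : (g • (Rᵀ * R) - restrict R (gramian A n)).PosSemidef := by
    have h := restrict_posSemidef R
      (posSemidef_smul_one_sub_of_norm_le (gramian_posSemidef A n).1 hg)
    rwa [restrict_sub, restrict_smul_one] at h
  have hL : (gammaLower C₀ k A R σ).PosDef := by
    have : (restrict R (gramian A k)).PosDef := by
      simpa using hRR.add_posSemidef hlow
    exact this.smul hspos
  have hU : (a • restrict R (gramian A n) + e • (Rᵀ * R)).PosSemidef :=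
    ((restrict_posSemidef R (gramian_posSemidef A n)).smul ha).add (hRR.posSemidef.smul he)
  have key : (c • gammaLower C₀ k A R σ
      - (a • restrict R (gramian A n) + e • (Rᵀ * R))).PosSemidef := by
    have h1 := ((hlow.smul (mul_nonneg (zero_le_one.trans hc) hspos.le)).add
      (hRR.posSemidef.smul (sub_nonneg.mpr hcl))).add (hup.smul ha)
    convert h1 using 1
    simp only [gammaLower, ← hs]
    module
  simpa using log_det_mul_inv_le hL hU hc key

end Restrict

section Toeplitz

lemma sum_ite_le_of_subsingleton {κ : Type*} [Fintype κ] {r : κ → Prop} [DecidablePred r]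
    (hr : ∀ a b, r a → r b → a = b) {x : ℝ} (hx : 0 ≤ x) : (∑ t, if r t then x else 0) ≤ x := by
  by_cases h : ∃ a, r a
  · obtain ⟨a, ha⟩ := h
    rw [Finset.sum_eq_single a (fun b _ hb => if_neg fun h => hb (hr b a h ha)) (by simp),
      if_pos ha]
  · push Not at h
    simpa [h] using hx

lemma sum_sq_mulVec_le {ι κ : Type*} [Fintype ι] [Fintype κ] [DecidableEq ι]
    (B : Matrix κ ι ℝ) (x : ι → ℝ) : ∑ i, (B *ᵥ x) i ^ 2 ≤ ‖B‖ ^ 2 * ∑ i, x i ^ 2 := by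
  have h := l2_opNorm_mulVec B (WithLp.toLp 2 x)
  have h1 := pow_le_pow_left₀ (norm_nonneg _) h 2
  rw [mul_pow, EuclideanSpace.real_norm_sq_eq, EuclideanSpace.real_norm_sq_eq] at h1
  simpa using h1

lemma norm_le_of_sum_sq_mulVec_le {ι κ : Type*} [Fintype ι] [Fintype κ] [DecidableEq ι]
    (B : Matrix κ ι ℝ) {c : ℝ} (hc : 0 ≤ c)
    (h : ∀ x : ι → ℝ, ∑ i, (B *ᵥ x) i ^ 2 ≤ c ^ 2 * ∑ i, x i ^ 2) : ‖B‖ ≤ c := by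
  rw [l2_opNorm_def]
  refine ContinuousLinearMap.opNorm_le_bound _ hc fun x => ?_
  refine le_of_sq_le_sq ?_ (mul_nonneg hc (norm_nonneg _))
  rw [mul_pow, EuclideanSpace.real_norm_sq_eq, EuclideanSpace.real_norm_sq_eq]
  simpa using h x

/-- A block matrix whose only nonzero blocks are copies of `B`, at most one in each block row
and each block column. -/
lemma norm_partialPerm_block_le {κ ι : Type*} [Fintype κ] [Fintype ι] [DecidableEq κ]
    [DecidableEq ι] {r : κ → κ → Prop} [DecidableRel r]
    (hrow : ∀ t a b, r t a → r t b → a = b) (hcol : ∀ s a b, r a s → r b s → a = b)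
    (B : Matrix ι ι ℝ) :
    ‖(Matrix.of fun p q : κ × ι => if r p.1 q.1 then B p.2 q.2 else 0)‖ ≤ ‖B‖ := by
  refine norm_le_of_sum_sq_mulVec_le _ (norm_nonneg _) fun x => ?_
  have hmul : ∀ t i, ((Matrix.of fun p q : κ × ι => if r p.1 q.1 then B p.2 q.2 else 0) *ᵥ x)
      (t, i) = ∑ s, if r t s then (B *ᵥ fun k => x (s, k)) i else 0 := by
    intro t i
    simp only [mulVec, dotProduct, Fintype.sum_prod_type, of_apply]
    refine Finset.sum_congr rfl fun s _ => ?_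
    split_ifs <;> simp
  have hrowle : ∀ t, ∑ i, (∑ s, if r t s then (B *ᵥ fun k => x (s, k)) i else 0) ^ 2
      ≤ ∑ s, if r t s then ‖B‖ ^ 2 * ∑ k, x (s, k) ^ 2 else 0 := by
    intro t
    by_cases h : ∃ s, r t s
    · obtain ⟨s, hs⟩ := h
      have hne : ∀ b, b ≠ s → ¬ r t b := fun b hb h => hb (hrow t b s h hs)
      have h1 : ∀ i, (∑ s, if r t s then (B *ᵥ fun k => x (s, k)) i else 0)
          = (B *ᵥ fun k => x (s, k)) i := fun i => by
        rw [Finset.sum_eq_single s (fun b _ hb => if_neg (hne b hb)) (by simp), if_pos hs]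
      rw [Finset.sum_eq_single s (fun b _ hb => if_neg (hne b hb)) (by simp), if_pos hs]
      simp only [h1]
      exact sum_sq_mulVec_le B fun k => x (s, k)
    · push Not at h
      simp [h]
  calc _ = ∑ t, ∑ i, (∑ s, if r t s then (B *ᵥ fun k => x (s, k)) i else 0) ^ 2 := by
        rw [Fintype.sum_prod_type]
        simp only [hmul]
    _ ≤ ∑ t, ∑ s, if r t s then ‖B‖ ^ 2 * ∑ k, x (s, k) ^ 2 else 0 :=
        Finset.sum_le_sum fun t _ => hrowle t
    _ = ∑ s, ∑ t, if r t s then ‖B‖ ^ 2 * ∑ k, x (s, k) ^ 2 else 0 := Finset.sum_comm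
    _ ≤ ∑ s, ‖B‖ ^ 2 * ∑ k, x (s, k) ^ 2 :=
        Finset.sum_le_sum fun s _ => sum_ite_le_of_subsingleton (hcol s)
          (mul_nonneg (sq_nonneg _) (Finset.sum_nonneg fun k _ => sq_nonneg _))
    _ = _ := by rw [← Finset.mul_sum, Fintype.sum_prod_type]

/-- The lower triangular block Toeplitz matrix with blocks `A ^ (t - s)`, `s ≤ t`. -/
def impulseMatrix {d : ℕ} (n : ℕ) (A : Matrix (Fin d) (Fin d) ℝ) :
    Matrix (Fin n × Fin d) (Fin n × Fin d) ℝ :=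
  Matrix.of fun p q => if q.1 ≤ p.1 then (A ^ ((p.1 : ℕ) - q.1)) p.2 q.2 else 0

lemma norm_impulseMatrix_le {d n : ℕ} (A : Matrix (Fin d) (Fin d) ℝ) :
    ‖impulseMatrix n A‖ ≤ ∑ j ∈ Finset.range n, ‖A ^ j‖ := by
  have h : impulseMatrix n A = ∑ j ∈ Finset.range n, Matrix.of fun p q : Fin n × Fin d =>
      if (q.1 : ℕ) + j = p.1 then (A ^ j) p.2 q.2 else 0 := by
    ext ⟨t, i⟩ ⟨s, k⟩
    simp only [impulseMatrix, of_apply, Matrix.sum_apply]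
    split_ifs with hst
    · have hst' : (s : ℕ) ≤ t := hst
      rw [Finset.sum_eq_single ((t : ℕ) - s), if_pos (by omega)]
      · intro j _ hj
        exact if_neg (by omega)
      · intro hj
        exact absurd (Finset.mem_range.mpr (by omega)) hj
    · have hst' : ¬ (s : ℕ) ≤ t := hst
      exact (Finset.sum_eq_zero fun j _ => if_neg (by omega)).symm
  rw [h]
  refine (norm_sum_le _ _).trans (Finset.sum_le_sum fun j _ => ?_)
  exact norm_partialPerm_block_le (r := fun t s : Fin n => (s : ℕ) + j = t)
    (fun t a b h1 h2 => by ext; omega) (fun s a b h1 h2 => by ext; omega) (A ^ j)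

end Toeplitz

section Autoregression

variable {Ω : Type u} {d : ℕ}

lemma process_eq_sum (A : Matrix (Fin d) (Fin d) ℝ) (η : ℕ → Ω → (Fin d → ℝ)) (t : ℕ) (ω : Ω) :
    process A η (t + 1) ω = ∑ s ∈ Finset.range (t + 1), A ^ (t - s) *ᵥ η s ω := by
  induction t with
  | zero => simp [process]
  | succ t ih =>
    simp only [process] at ih ⊢
    rw [ih, Finset.sum_range_succ _ (t + 1), mulVec_sum]
    congr 1
    · refine Finset.sum_congr rfl fun s hs => ?_
      have : t + 1 - s = (t - s) + 1 := by have := Finset.mem_range.mp hs; omega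
      rw [this, pow_succ', mulVec_mulVec]
    · simp

lemma process_eq_impulseMatrix {n : ℕ} (A : Matrix (Fin d) (Fin d) ℝ)
    (η : ℕ → Ω → (Fin d → ℝ)) (p : Fin n × Fin d) (ω : Ω) :
    process A η (p.1 + 1) ω p.2 = ∑ q, impulseMatrix n A p q * η (q.1 : ℕ) ω q.2 := by
  obtain ⟨t, i⟩ := p
  rw [process_eq_sum, Fintype.sum_prod_type, Finset.sum_apply]
  have h1 : ∀ s : Fin n, (∑ k, impulseMatrix n A (t, i) (s, k) * η s ω k)
      = if (s : ℕ) < t + 1 then (A ^ ((t : ℕ) - s) *ᵥ η s ω) i else 0 := by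
    intro s
    have : ((s : ℕ) < t + 1) ↔ s ≤ t := by rw [Nat.lt_succ_iff, Fin.le_def]
    simp only [impulseMatrix, of_apply, this]
    split_ifs <;> simp [mulVec, dotProduct]
  simp only [h1]
  rw [Fin.sum_univ_eq_sum_range
    (fun s => if s < (t : ℕ) + 1 then (A ^ ((t : ℕ) - s) *ᵥ η s ω) i else 0) n,
    ← Finset.sum_filter]
  refine Finset.sum_congr ?_ fun _ _ => rfl
  ext s
  simp only [Finset.mem_range, Finset.mem_filter]
  omega

variable [MeasurableSpace Ω] {P : Measure Ω} {σ : ℝ} {η : ℕ → Ω → (Fin d → ℝ)}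

lemma IsInnovation.covariance_eq (h : IsInnovation P σ η) (s t : ℕ) (i j : Fin d) :
    covariance (fun ω => η s ω i) (fun ω => η t ω j) P = if s = t ∧ i = j then σ ^ 2 else 0 := by
  by_cases hst : s = t
  · subst hst
    simp [h.cov]
  · have h1 : IndepFun (fun ω => η s ω i) (fun ω => η t ω j) P :=
      (h.indep.indepFun hst).comp (measurable_pi_apply i) (measurable_pi_apply j)
    rw [h1.covariance_eq_zero (h.memLp s i) (h.memLp t j), if_neg (fun h => hst h.1)]

lemma sigmaX_eq [IsProbabilityMeasure P] (h : IsInnovation P σ η) (n : ℕ)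
    (A : Matrix (Fin d) (Fin d) ℝ) :
    sigmaX P n A η = σ ^ 2 • (impulseMatrix n A * (impulseMatrix n A)ᵀ) := by
  ext p q
  simp only [sigmaX, of_apply, process_eq_impulseMatrix]
  rw [covariance_fun_sum_fun_sum (fun a => (h.memLp _ _).const_mul _)
    (fun a => (h.memLp _ _).const_mul _)]
  simp only [covariance_const_mul_left, covariance_const_mul_right, h.covariance_eq,
    Matrix.smul_apply, Matrix.mul_apply, transpose_apply, smul_eq_mul, Finset.mul_sum]
  refine Finset.sum_congr rfl fun a _ => ?_
  have hab : ∀ b : Fin n × Fin d, ((a.1 : ℕ) = b.1 ∧ a.2 = b.2) ↔ a = b := fun b => by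
    rw [Prod.ext_iff, Fin.ext_iff (a := a.1)]
  simp only [hab]
  simp
  ring

lemma specNorm_sigmaX_le [IsProbabilityMeasure P] (h : IsInnovation P σ η) (n : ℕ)
    (A : Matrix (Fin d) (Fin d) ℝ) :
    specNorm (sigmaX P n A η) ≤ σ ^ 2 * (∑ j ∈ Finset.range n, ‖A ^ j‖) ^ 2 := by
  rw [specNorm_eq_norm, sigmaX_eq h, norm_smul, Real.norm_of_nonneg (sq_nonneg σ),
    ← conjTranspose_eq_transpose_of_trivial]
  refine mul_le_mul_of_nonneg_left ?_ (sq_nonneg σ)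
  refine (norm_mul_le _ _).trans ?_
  rw [l2_opNorm_conjTranspose, ← sq]
  exact pow_le_pow_left₀ (norm_nonneg _) (norm_impulseMatrix_le A) 2

end Autoregression

section Complex

variable {ι : Type*} [Fintype ι] [DecidableEq ι]

lemma sum_norm_sq_mulVec_le (B : Matrix ι ι ℂ) (x : ι → ℂ) :
    ∑ i, ‖(B *ᵥ x) i‖ ^ 2 ≤ ‖B‖ ^ 2 * ∑ i, ‖x i‖ ^ 2 := by
  have h := l2_opNorm_mulVec B (WithLp.toLp 2 x)
  have h1 := pow_le_pow_left₀ (norm_nonneg _) h 2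
  rw [mul_pow, EuclideanSpace.norm_sq_eq, EuclideanSpace.norm_sq_eq] at h1
  simpa using h1

lemma norm_le_of_sum_norm_sq_mulVec_le (B : Matrix ι ι ℂ) {c : ℝ} (hc : 0 ≤ c)
    (h : ∀ x : ι → ℂ, ∑ i, ‖(B *ᵥ x) i‖ ^ 2 ≤ c ^ 2 * ∑ i, ‖x i‖ ^ 2) : ‖B‖ ≤ c := by
  rw [l2_opNorm_def]
  refine ContinuousLinearMap.opNorm_le_bound _ hc fun x => ?_
  refine le_of_sq_le_sq ?_ (mul_nonneg hc (norm_nonneg _))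
  rw [mul_pow, EuclideanSpace.norm_sq_eq, EuclideanSpace.norm_sq_eq]
  simpa using h x

lemma norm_le_norm_cplx (M : Matrix ι ι ℝ) : ‖M‖ ≤ ‖cplx M‖ := by
  refine norm_le_of_sum_sq_mulVec_le M (norm_nonneg _) fun x => ?_
  have h := sum_norm_sq_mulVec_le (cplx M) (fun i => (x i : ℂ))
  have h1 : ∀ i, (cplx M *ᵥ fun i => (x i : ℂ)) i = ((M *ᵥ x) i : ℝ) := fun i => by
    simp [cplx, mulVec, dotProduct]
  simpa [h1] using h

lemma cplx_pow (M : Matrix ι ι ℝ) (s : ℕ) : cplx (M ^ s) = cplx M ^ s :=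
  map_pow (algebraMap ℝ ℂ).mapMatrix M s

lemma norm_le_card_mul_of_entry_le (B : Matrix ι ι ℂ) {x : ℝ} (hx : 0 ≤ x)
    (h : ∀ i j, ‖B i j‖ ≤ x) : ‖B‖ ≤ Fintype.card ι * x := by
  refine norm_le_of_sum_norm_sq_mulVec_le B (by positivity) fun v => ?_
  have h1 : ∀ i, ‖(B *ᵥ v) i‖ ^ 2 ≤ x ^ 2 * (Fintype.card ι * ∑ j, ‖v j‖ ^ 2) := by
    intro i
    have h2 : ‖(B *ᵥ v) i‖ ≤ x * ∑ j, ‖v j‖ := by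
      rw [Finset.mul_sum]
      refine (norm_sum_le _ _).trans (Finset.sum_le_sum fun j _ => ?_)
      rw [norm_mul]
      exact mul_le_mul_of_nonneg_right (h i j) (norm_nonneg _)
    have h3 : (∑ j, ‖v j‖) ^ 2 ≤ Fintype.card ι * ∑ j, ‖v j‖ ^ 2 := by
      simpa using sq_sum_le_card_mul_sum_sq (s := Finset.univ) (f := fun j => ‖v j‖)
    calc _ ≤ (x * ∑ j, ‖v j‖) ^ 2 := pow_le_pow_left₀ (norm_nonneg _) h2 2
      _ = x ^ 2 * (∑ j, ‖v j‖) ^ 2 := by ring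
      _ ≤ _ := mul_le_mul_of_nonneg_left h3 (sq_nonneg _)
  calc _ ≤ ∑ _i : ι, x ^ 2 * (Fintype.card ι * ∑ j, ‖v j‖ ^ 2) :=
        Finset.sum_le_sum fun i _ => h1 i
    _ = _ := by
        simp only [Finset.sum_const, Finset.card_univ, nsmul_eq_mul]
        ring

lemma norm_le_specRad_of_mem [Nonempty ι] (M : Matrix ι ι ℝ) {z : ℂ}
    (hz : z ∈ spectrum ℂ (cplx M)) : ‖z‖ ≤ specRad M := by
  have hfin : spectralRadius ℂ (cplx M) ≠ ⊤ :=
    ((spectrum.spectralRadius_le_nnnorm (𝕜 := ℂ) (cplx M)).trans_lt ENNReal.coe_lt_top).ne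
  have h : (‖z‖₊ : ENNReal) ≤ spectralRadius ℂ (cplx M) :=
    le_iSup₂ (f := fun k (_ : k ∈ spectrum ℂ (cplx M)) => (‖k‖₊ : ENNReal)) z hz
  simpa [specRad] using ENNReal.toReal_mono hfin h

/-- By Gelfand's formula, `‖M ^ s‖ ≤ a ^ s` eventually, as soon as `ρ(M) < a`. -/
lemma eventually_norm_pow_le [Nonempty ι] (M : Matrix ι ι ℝ) {a : ℝ} (ha : specRad M < a) :
    ∃ N : ℕ, ∀ s, N ≤ s → ‖M ^ s‖ ≤ a ^ s := by
  have hfin : spectralRadius ℂ (cplx M) ≠ ⊤ :=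
    ((spectrum.spectralRadius_le_nnnorm (𝕜 := ℂ) (cplx M)).trans_lt ENNReal.coe_lt_top).ne
  have ha0 : 0 ≤ a := ENNReal.toReal_nonneg.trans ha.le
  have hlt : spectralRadius ℂ (cplx M) < ENNReal.ofReal a := by
    rwa [← ENNReal.ofReal_toReal hfin, ENNReal.ofReal_lt_ofReal_iff_of_nonneg
      ENNReal.toReal_nonneg]
  have hev := (spectrum.pow_norm_pow_one_div_tendsto_nhds_spectralRadius
    (cplx M)).eventually_lt_const hlt
  obtain ⟨N, hN⟩ := Filter.eventually_atTop.mp hev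
  refine ⟨max N 1, fun s hs => ?_⟩
  have hs1 : s ≠ 0 := by have := le_max_right N 1; omega
  have h1 := hN s ((le_max_left _ _).trans hs)
  have h2 : ‖cplx M ^ s‖ ^ (1 / s : ℝ) ≤ a := (ENNReal.ofReal_lt_ofReal_iff'.mp h1).1.le
  calc ‖M ^ s‖ ≤ ‖cplx M ^ s‖ := by rw [← cplx_pow]; exact norm_le_norm_cplx _
    _ = (‖cplx M ^ s‖ ^ (1 / s : ℝ)) ^ s := by
        rw [one_div, Real.rpow_inv_natCast_pow (norm_nonneg _) hs1]
    _ ≤ a ^ s := pow_le_pow_left₀ (by positivity) h2 s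

lemma norm_pow_le_of_decayIndex_le [Nonempty ι] {M : Matrix ι ι ℝ} {r : ℝ} (hr : r < 1)
    (hM : specRad M ≤ r) {s : ℕ} (hs : decayIndex r M ≤ s) :
    ‖M ^ s‖ ≤ ((1 + r) / 2) ^ s :=
  Nat.sInf_mem (s := {N : ℕ | ∀ s : ℕ, N ≤ s → specNorm (M ^ s) ≤ ((1 + r) / 2) ^ s})
    (eventually_norm_pow_le M (by linarith)) s hs

end Complex

section ConditionNumber

variable {ι : Type*} [Fintype ι] [DecidableEq ι]

lemma lamMin_conjTranspose_mul_self_pos [Nonempty ι] {S : Matrix ι ι ℂ} (hS : IsUnit S) :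
    0 < lamMin (Sᴴ * S) := by
  open scoped ComplexOrder in
  have hpd : (Sᴴ * S).PosDef :=
    PosDef.conjTranspose_mul_self S (mulVec_injective_iff_isUnit.mpr hS)
  have hmem : lamMin (Sᴴ * S) ∈ spectrum ℝ (Sᴴ * S) :=
    Set.Nonempty.csInf_mem ⟨_, hpd.1.eigenvalues_mem_spectrum_real (Classical.arbitrary ι)⟩
      finite_real_spectrum
  rw [hpd.1.spectrum_real_eq_range_eigenvalues] at hmem
  obtain ⟨i, hi⟩ := hmem
  exact hi ▸ hpd.eigenvalues_pos i

lemma norm_mul_norm_inv_le_condNum [Nonempty ι] {S : Matrix ι ι ℂ} (hS : IsUnit S) :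
    ‖S‖ * ‖S⁻¹‖ ≤ condNum S := by
  open scoped MatrixOrder in
  set H := Sᴴ * S with hH
  have hfin : (spectrum ℝ H).Finite := finite_real_spectrum
  have hmin := lamMin_conjTranspose_mul_self_pos hS
  have hHu : IsUnit H := by
    rw [hH, ← star_eq_conjTranspose]
    exact hS.star.mul hS
  have h1 : ‖S‖ ^ 2 ≤ lamMax H := by
    have h := CStarAlgebra.norm_mem_spectrum_of_nonneg (a := H) (star_mul_self_nonneg S)
    rw [hH, l2_opNorm_conjTranspose_mul_self, ← sq] at h
    exact le_csSup hfin.bddAbove h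
  have hinv : H⁻¹ = S⁻¹ * (S⁻¹)ᴴ := by
    rw [hH, Matrix.mul_inv_rev, conjTranspose_nonsing_inv]
  have hnorm : ‖H⁻¹‖ = ‖S⁻¹‖ ^ 2 := by
    have := l2_opNorm_conjTranspose_mul_self (S⁻¹)ᴴ
    rw [conjTranspose_conjTranspose, l2_opNorm_conjTranspose, ← sq] at this
    rw [hinv, this]
  have hpos : 0 < ‖S⁻¹‖ := by
    rw [norm_pos_iff]
    intro h0
    have h := mul_nonsing_inv S ((isUnit_iff_isUnit_det S).mp hS)
    rw [h0, mul_zero] at h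
    exact zero_ne_one h
  have h2 : lamMin H ≤ (‖S⁻¹‖ ^ 2)⁻¹ := by
    have h : ‖H⁻¹‖ ∈ spectrum ℝ H⁻¹ :=
      CStarAlgebra.norm_mem_spectrum_of_nonneg (by rw [hinv]; exact mul_star_self_nonneg S⁻¹)
    rw [hnorm] at h
    obtain ⟨u, hu⟩ := hHu
    have hr : ((Units.mk0 (‖S⁻¹‖ ^ 2) (by positivity) : ℝˣ) : ℝ)
        ∈ spectrum ℝ ((u⁻¹ : (Matrix ι ι ℂ)ˣ) : Matrix ι ι ℂ) := by
      rwa [Matrix.coe_units_inv, hu]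
    have h3 := spectrum.inv_mem_iff.mp hr
    rw [inv_inv, hu] at h3
    exact csInf_le hfin.bddBelow (by simpa using h3)
  rw [condNum]
  refine Real.le_sqrt_of_sq_le ?_
  rw [le_div_iff₀ hmin, mul_pow]
  have h4 : ‖S⁻¹‖ ^ 2 * lamMin H ≤ 1 := by
    calc _ ≤ ‖S⁻¹‖ ^ 2 * (‖S⁻¹‖ ^ 2)⁻¹ := mul_le_mul_of_nonneg_left h2 (sq_nonneg _)
      _ = 1 := mul_inv_cancel₀ (by positivity)
  calc ‖S‖ ^ 2 * ‖S⁻¹‖ ^ 2 * lamMin H = ‖S‖ ^ 2 * (‖S⁻¹‖ ^ 2 * lamMin H) := by ring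
    _ ≤ ‖S‖ ^ 2 * 1 := mul_le_mul_of_nonneg_left h4 (sq_nonneg _)
    _ ≤ lamMax H := by simpa using h1

lemma one_le_condNum [Nonempty ι] {S : Matrix ι ι ℂ} (hS : IsUnit S) : 1 ≤ condNum S := by
  refine le_trans ?_ (norm_mul_norm_inv_le_condNum hS)
  rw [← norm_one (α := Matrix ι ι ℂ), ← mul_nonsing_inv S ((isUnit_iff_isUnit_det S).mp hS)]
  exact norm_mul_le _ _

end ConditionNumber

section Jordan

lemma jordanBlock_pow_entry_le {b : ℕ} {z : ℂ} {M : ℝ} (hM : 1 ≤ M) (hz : ‖z‖ ≤ M) (s : ℕ)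
    (i j : Fin b) : ‖(jordanBlock b z ^ s) i j‖ ≤ M ^ s * (1 + s) ^ (j : ℕ) := by
  have hM0 : 0 ≤ M := zero_le_one.trans hM
  induction s generalizing j with
  | zero =>
    rw [pow_zero, Matrix.one_apply]
    split_ifs <;> simp
  | succ s ih =>
    have hstep : ‖(jordanBlock b z ^ (s + 1)) i j‖ ≤ ‖(jordanBlock b z ^ s) i j‖ * ‖z‖
        + ∑ k : Fin b, if (k : ℕ) + 1 = j then ‖(jordanBlock b z ^ s) i k‖ else 0 := by
      have h1 : (jordanBlock b z ^ (s + 1)) i j = (jordanBlock b z ^ s) i j * z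
          + ∑ k : Fin b, if (k : ℕ) + 1 = j then (jordanBlock b z ^ s) i k else 0 := by
        rw [pow_succ, Matrix.mul_apply]
        have h2 : ∀ k, (jordanBlock b z ^ s) i k * jordanBlock b z k j
            = (if k = j then (jordanBlock b z ^ s) i k * z else 0)
              + if (k : ℕ) + 1 = j then (jordanBlock b z ^ s) i k else 0 := by
          intro k
          simp only [jordanBlock, of_apply]
          by_cases hkj : k = j
          · subst hkj
            simp
          · simp [hkj]
        simp only [h2, Finset.sum_add_distrib]
        simp
      rw [h1]
      refine (norm_add_le _ _).trans (add_le_add (norm_mul_le _ _)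
        ((norm_sum_le _ _).trans (Finset.sum_le_sum fun k _ => ?_)))
      split_ifs <;> simp
    have hfirst : ‖(jordanBlock b z ^ s) i j‖ * ‖z‖ ≤ M ^ (s + 1) * (1 + s) ^ (j : ℕ) := by
      calc _ ≤ M ^ s * (1 + s) ^ (j : ℕ) * M := by
            have := ih j
            gcongr
        _ = _ := by ring
    have hMs : M ^ s ≤ M ^ (s + 1) := pow_le_pow_right₀ hM (Nat.le_succ s)
    obtain ⟨j, hj⟩ := j
    rcases j with _ | j
    · have h0 : (∑ k : Fin b, if (k : ℕ) + 1 = 0 then ‖(jordanBlock b z ^ s) i k‖ else 0) = 0 :=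
        Finset.sum_eq_zero fun k _ => if_neg (by omega)
      simp only [h0, add_zero] at hstep
      simpa using hstep.trans hfirst
    · have h0 : (∑ k : Fin b, if (k : ℕ) + 1 = j + 1 then ‖(jordanBlock b z ^ s) i k‖ else 0)
          = ‖(jordanBlock b z ^ s) i ⟨j, by omega⟩‖ := by
        rw [Finset.sum_eq_single ⟨j, by omega⟩]
        · simp
        · intro k _ hk
          exact if_neg fun h => hk (by ext; simpa using h)
        · simp
      simp only [h0] at hstep
      refine (hstep.trans (add_le_add hfirst (ih _))).trans ?_
      push_cast
      have h3 : (1 + s : ℝ) ^ j ≤ (1 + (s + 1)) ^ j := by gcongr; linarith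
      calc M ^ (s + 1) * (1 + s : ℝ) ^ (j + 1) + M ^ s * (1 + s) ^ j
          ≤ M ^ (s + 1) * (1 + s : ℝ) ^ (j + 1) + M ^ (s + 1) * (1 + s) ^ j := by gcongr
        _ = M ^ (s + 1) * ((1 + (s + 1)) * (1 + s : ℝ) ^ j) := by ring
        _ ≤ M ^ (s + 1) * ((1 + (s + 1)) * (1 + (s + 1) : ℝ) ^ j) := by gcongr
        _ = _ := by ring

lemma jordanMatrix_pow_entry_le {d L : ℕ} {b : Fin L → ℕ} (hb : ∑ l, b l = d)
    {eig : Fin L → ℂ} {M : ℝ} (hM : 1 ≤ M) (hz : ∀ l, ‖eig l‖ ≤ M) (s : ℕ) (i j : Fin d) :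
    ‖(jordanMatrix b hb eig ^ s) i j‖ ≤ M ^ s * (1 + s) ^ (Finset.univ.sup b) := by
  have h : jordanMatrix b hb eig ^ s = Matrix.reindexAlgEquiv ℂ ℂ
      (finSigmaFinEquiv.trans (finCongr hb))
      (Matrix.blockDiagonal' fun l => jordanBlock (b l) (eig l) ^ s) := by
    rw [← Pi.pow_def, blockDiagonal'_pow, map_pow]
    rfl
  rw [h, coe_reindexAlgEquiv, reindex_apply, submatrix_apply]
  obtain ⟨k, i⟩ := (finSigmaFinEquiv.trans (finCongr hb)).symm i
  obtain ⟨l, j⟩ := (finSigmaFinEquiv.trans (finCongr hb)).symm j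
  by_cases hkl : k = l
  · subst hkl
    rw [blockDiagonal'_apply_eq]
    refine (jordanBlock_pow_entry_le hM (hz k) s i j).trans ?_
    have hs : (1 : ℝ) ≤ 1 + s := by simp
    have hj : (j : ℕ) ≤ Finset.univ.sup b := j.2.le.trans (Finset.le_sup (Finset.mem_univ k))
    gcongr
  · rw [blockDiagonal'_apply_ne _ _ _ hkl, norm_zero]
    positivity

lemma eig_mem_spectrum_jordanMatrix {d L : ℕ} {b : Fin L → ℕ} (hb : ∑ l, b l = d)
    {eig : Fin L → ℂ} (h1 : ∀ l, 1 ≤ b l) (l : Fin L) :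
    eig l ∈ spectrum ℂ (jordanMatrix b hb eig) := by
  have h : jordanMatrix b hb eig = Matrix.reindexAlgEquiv ℂ ℂ
      (finSigmaFinEquiv.trans (finCongr hb))
      (Matrix.blockDiagonal' fun l => jordanBlock (b l) (eig l)) := rfl
  rw [h, AlgEquiv.spectrum_eq, spectrum.mem_iff, isUnit_iff_isUnit_det, isUnit_iff_ne_zero,
    not_not]
  refine det_eq_zero_of_column_eq_zero ⟨l, ⟨0, h1 l⟩⟩ fun ⟨k, i⟩ => ?_
  rw [Algebra.algebraMap_eq_smul_one, Matrix.sub_apply, Matrix.smul_apply]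
  by_cases hkl : k = l
  · subst hkl
    rw [blockDiagonal'_apply_eq, Matrix.one_apply]
    by_cases hi : i = ⟨0, h1 k⟩
    · subst hi
      simp [jordanBlock]
    · simp [jordanBlock, hi]
  · rw [blockDiagonal'_apply_ne _ _ _ hkl, Matrix.one_apply_ne (by simp [hkl])]
    simp

lemma JordanDecomposition.norm_pow_le {d : ℕ} [NeZero d] {A : Matrix (Fin d) (Fin d) ℝ}
    (D : JordanDecomposition A) {M : ℝ} (hM : 1 ≤ M) (hA : specRad A ≤ M) (s : ℕ) :
    ‖A ^ s‖ ≤ d * condNum D.S * (M ^ s * (1 + s) ^ D.bMax) := by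
  have hdet := (isUnit_iff_isUnit_det D.S).mp D.isUnit_S
  have heig : ∀ l, ‖D.eig l‖ ≤ M := fun l => by
    refine (norm_le_specRad_of_mem A ?_).trans hA
    obtain ⟨u, hu⟩ := D.isUnit_S
    have : cplx A = u * jordanMatrix D.b D.sum_b D.eig * (u⁻¹ : (Matrix _ _ ℂ)ˣ) := by
      rw [Matrix.coe_units_inv, hu]
      exact D.eq_conj
    rw [this, spectrum.units_conjugate]
    exact eig_mem_spectrum_jordanMatrix D.sum_b D.one_le_b l
  have hpow : cplx A ^ s = D.S * jordanMatrix D.b D.sum_b D.eig ^ s * D.S⁻¹ := by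
    rw [D.eq_conj]
    induction s with
    | zero => simp [mul_nonsing_inv _ hdet]
    | succ s ih =>
      rw [pow_succ, ih, pow_succ]
      simp only [mul_assoc]
      rw [← mul_assoc D.S⁻¹ D.S, nonsing_inv_mul _ hdet, one_mul]
  have hJ : ‖jordanMatrix D.b D.sum_b D.eig ^ s‖ ≤ d * (M ^ s * (1 + s) ^ D.bMax) := by
    simpa [JordanDecomposition.bMax] using norm_le_card_mul_of_entry_le _ (by positivity)
      (jordanMatrix_pow_entry_le D.sum_b hM heig s)
  calc ‖A ^ s‖ ≤ ‖cplx A ^ s‖ := by rw [← cplx_pow]; exact norm_le_norm_cplx _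
    _ ≤ ‖D.S‖ * ‖jordanMatrix D.b D.sum_b D.eig ^ s‖ * ‖D.S⁻¹‖ := by
        rw [hpow]
        exact (norm_mul_le _ _).trans (mul_le_mul_of_nonneg_right (norm_mul_le _ _)
          (norm_nonneg _))
    _ = ‖D.S‖ * ‖D.S⁻¹‖ * ‖jordanMatrix D.b D.sum_b D.eig ^ s‖ := by ring
    _ ≤ condNum D.S * (d * (M ^ s * (1 + s) ^ D.bMax)) :=
        mul_le_mul (norm_mul_norm_inv_le_condNum D.isUnit_S) hJ (norm_nonneg _)
          (Real.sqrt_nonneg _)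
    _ = _ := by ring

end Jordan

section UpperMatrices

variable {n d m k : ℕ} {A : Matrix (Fin d) (Fin d) ℝ} {R : Matrix (Fin d × Fin d) (Fin m) ℝ}
  {σ δ C₀ C₁ : ℝ}

lemma IsSetting.two_le (h : IsSetting n k R σ δ) : 2 ≤ n := by
  have h1 := h.one_le_k
  have h2 := h.k_le
  omega

lemma IsSetting.neZero (h : IsSetting n k R σ δ) : NeZero d := ⟨by have := h.one_le_d; omega⟩

lemma IsSetting.le_sq (h : IsSetting n k R σ δ) : m ≤ d ^ 2 := by
  have h1 := R.rank_le_card_height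
  rw [h.rank_R, Fintype.card_prod, Fintype.card_fin] at h1
  rwa [sq]

lemma IsSetting.psi_nonneg (h : IsSetting n k R σ δ) (hC₁ : 0 < C₁) : 0 ≤ psi C₁ m d δ := by
  have h9 : 0 ≤ Real.log 9 := Real.log_nonneg (by norm_num)
  have hd : 0 ≤ Real.log d := Real.log_natCast_nonneg d
  have hδ : 0 ≤ Real.log (2 / δ) := Real.log_nonneg (by
    rw [le_div_iff₀ h.delta_pos]
    linarith [h.delta_lt_one])
  unfold psi
  positivity

lemma log_nine_le : Real.log 9 ≤ 8 :=
  (Real.log_le_sub_one_of_pos (by norm_num)).trans (by norm_num)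

lemma log_det_gammaUpper₁_le (h : IsSetting n k R σ δ) (hC₀ : 0 < C₀) {G c : ℝ}
    (hG : ∑ s ∈ Finset.range n, ‖A ^ s‖ ^ 2 ≤ G) (hc : 1 ≤ c)
    (hcl : (4 * C₀) ^ 2 * (m / δ * G) ≤ c) :
    Real.log (gammaUpper₁ n A R σ δ * (gammaLower C₀ k A R σ)⁻¹).det ≤ m * Real.log c := by
  have hδ := h.delta_pos
  have hσ := h.sigma_pos
  have key := log_det_upper_mul_lower_inv_le h hC₀ (A := A) (a := σ ^ 2 * m / δ) (e := 0)
    (by positivity) le_rfl ((norm_gramian_le A n).trans hG) hc (by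
      rw [div_mul_eq_mul_div (σ ^ 2) _ c, le_div_iff₀ (by positivity)]
      calc _ = σ ^ 2 * ((4 * C₀) ^ 2 * (m / δ * G)) := by ring
        _ ≤ σ ^ 2 * c := by gcongr)
  simpa [gammaUpper₁] using key

variable {Ω : Type u} [MeasurableSpace Ω] {P : Measure Ω}
  {η : ℕ → Ω → (Fin d → ℝ)}

lemma xi_nonneg (h : IsSetting n k R σ δ) (hC₁ : 0 < C₁) : 0 ≤ xi P C₁ m n A η σ δ := by
  have hψ := h.psi_nonneg hC₁
  have hS : 0 ≤ specNorm (sigmaX P n A η) := norm_nonneg _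
  unfold xi
  positivity

lemma xi_le [IsProbabilityMeasure P] (h : IsSetting n k R σ δ) (hη : IsInnovation P σ η)
    (hC₁ : 0 < C₁) {G H : ℝ}
    (hG : ∑ s ∈ Finset.range n, ‖A ^ s‖ ^ 2 ≤ G) (hH : ∑ s ∈ Finset.range n, ‖A ^ s‖ ≤ H) :
    xi P C₁ m n A η σ δ ≤ G + 3 * (psi C₁ m d δ * H ^ 2 / n) := by
  have := h.neZero
  have hσ := h.sigma_pos
  have hn : (0 : ℝ) < n := by have := h.two_le; positivity
  have hψ := h.psi_nonneg hC₁
  set T := psi C₁ m d δ * H ^ 2 / n with hT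
  have hT0 : 0 ≤ T := by positivity
  have hG0 : 0 ≤ G := (Finset.sum_nonneg fun s _ => sq_nonneg ‖A ^ s‖).trans hG
  have hS : specNorm (sigmaX P n A η) ≤ σ ^ 2 * H ^ 2 := by
    refine (specNorm_sigmaX_le hη n A).trans ?_
    gcongr
  have hS0 : 0 ≤ specNorm (sigmaX P n A η) := norm_nonneg _
  set Q := psi C₁ m d δ * specNorm (sigmaX P n A η) / (σ ^ 2 * n) with hQ
  have hQ0 : 0 ≤ Q := by positivity
  have hQT : Q ≤ T := by
    rw [hQ, hT, div_le_div_iff₀ (by positivity) hn]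
    calc _ ≤ psi C₁ m d δ * (σ ^ 2 * H ^ 2) * n := by gcongr
      _ = _ := by ring
  have hlam : lamMax (gramian A n) ≤ G :=
    (lamMax_le_norm _).trans ((norm_gramian_le A n).trans hG)
  have hxi : xi P C₁ m n A η σ δ = 2 * Real.sqrt (lamMax (gramian A n) * Q) + 2 * Q := by
    simp only [xi, hQ]
    congr 3 <;> ring
  have hsqrt : Real.sqrt (lamMax (gramian A n) * Q) ≤ (G + T) / 2 := by
    refine Real.sqrt_le_iff.mpr ⟨by positivity, ?_⟩
    calc lamMax (gramian A n) * Q ≤ G * T := by gcongr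
      _ ≤ ((G + T) / 2) ^ 2 := by nlinarith [sq_nonneg (G - T)]
  rw [hxi]
  linarith

lemma log_det_gammaUpper₂_le [IsProbabilityMeasure P] (h : IsSetting n k R σ δ) (hη : IsInnovation P σ η)
    (hC₀ : 0 < C₀) (hC₁ : 0 < C₁) {G H c : ℝ} (hG : ∑ s ∈ Finset.range n, ‖A ^ s‖ ^ 2 ≤ G)
    (hH : ∑ s ∈ Finset.range n, ‖A ^ s‖ ≤ H) (hc : 1 ≤ c)
    (hcl : (4 * C₀) ^ 2 * (2 * G + 3 * (psi C₁ m d δ * H ^ 2 / n)) ≤ c) :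
    Real.log (gammaUpper₂ P C₁ n A η R σ δ * (gammaLower C₀ k A R σ)⁻¹).det
      ≤ m * Real.log c := by
  have hσ := h.sigma_pos
  have hxi := xi_le h hη hC₁ hG hH
  refine log_det_upper_mul_lower_inv_le h hC₀ (by positivity)
    (mul_nonneg (sq_nonneg σ) (xi_nonneg h hC₁)) ((norm_gramian_le A n).trans hG) hc ?_
  rw [div_mul_eq_mul_div, le_div_iff₀ (by positivity)]
  calc _ = σ ^ 2 * ((4 * C₀) ^ 2 * (G + xi P C₁ m n A η σ δ)) := by ring
    _ ≤ σ ^ 2 * ((4 * C₀) ^ 2 * (2 * G + 3 * (psi C₁ m d δ * H ^ 2 / n))) := by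
        have : G + xi P C₁ m n A η σ δ ≤ 2 * G + 3 * (psi C₁ m d δ * H ^ 2 / n) := by linarith
        gcongr
    _ ≤ σ ^ 2 * c := by gcongr

end UpperMatrices

section GeneralCase

variable {n d m k : ℕ} {A : Matrix (Fin d) (Fin d) ℝ} {R : Matrix (Fin d × Fin d) (Fin m) ℝ}
  {σ δ C₀ C₁ c : ℝ}

lemma JordanDecomposition.one_le_bMax [NeZero d] (D : JordanDecomposition A) : 1 ≤ D.bMax := by
  by_contra hb
  have h0 : ∀ l, D.b l = 0 := fun l => by
    have : D.b l ≤ D.bMax := Finset.le_sup (f := D.b) (Finset.mem_univ l)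
    omega
  have := D.sum_b
  simp only [h0, Finset.sum_const_zero] at this
  exact NeZero.ne d this.symm

lemma JordanDecomposition.norm_pow_le_of_lt [NeZero d] (D : JordanDecomposition A) (hc : 0 < c)
    (hA : specRad A ≤ 1 + c / n) {s : ℕ} (hs : s < n) :
    ‖A ^ s‖ ≤ d * condNum D.S * (Real.exp c * n ^ D.bMax) := by
  have hn : (0 : ℝ) < n := by exact_mod_cast (Nat.zero_le s).trans_lt hs
  have hM : (1 : ℝ) ≤ 1 + c / n := by
    have : 0 ≤ c / n := by positivity
    linarith
  have hcond : 0 ≤ condNum D.S := Real.sqrt_nonneg _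
  refine (D.norm_pow_le hM hA s).trans ?_
  have h1 : (1 + c / n) ^ s ≤ Real.exp c := by
    calc (1 + c / n) ^ s ≤ (1 + c / n) ^ n := pow_le_pow_right₀ hM hs.le
      _ ≤ Real.exp (c / n) ^ n := by
          gcongr
          linarith [Real.add_one_le_exp (c / n)]
      _ = Real.exp c := by
          rw [← Real.exp_nat_mul]
          congr 1
          field_simp
  have h2 : (1 + s : ℝ) ≤ n := by exact_mod_cast (by omega : 1 + s ≤ n)
  gcongr

lemma IsSetting.psi_le (h : IsSetting n k R σ δ) (hC₁ : 0 < C₁) {q : ℝ} (hq : 1 ≤ q)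
    (hdq : d ≤ q) (hδq : 1 / δ ≤ q) : psi C₁ m d δ ≤ 11 * C₁ * q ^ 2 := by
  have hδ := h.delta_pos
  have hmq : (m : ℝ) ≤ q ^ 2 := by
    calc (m : ℝ) ≤ (d : ℝ) ^ 2 := by exact_mod_cast h.le_sq
      _ ≤ q ^ 2 := by gcongr
  have hqq : q ≤ q ^ 2 := by nlinarith
  have h1 : Real.log d ≤ q := (Real.log_le_self (Nat.cast_nonneg d)).trans hdq
  have h2 : Real.log (2 / δ) ≤ 2 * q := by
    refine (Real.log_le_self (by positivity)).trans ?_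
    calc 2 / δ = 2 * (1 / δ) := by ring
      _ ≤ _ := by gcongr
  have h3 : (m : ℝ) * Real.log 9 ≤ q ^ 2 * 8 := by
    have := log_nine_le
    have h9 : 0 ≤ Real.log 9 := Real.log_nonneg (by norm_num)
    gcongr
  unfold psi
  calc _ ≤ C₁ * (11 * q ^ 2) := by
        gcongr
        linarith
    _ = _ := by ring

lemma log_mul_pow_mul_pow_le {M q : ℝ} (hM : 1 ≤ M) (hq : 1 ≤ q) (hn : 2 ≤ n) {b : ℕ}
    (hb : 1 ≤ b) :
    Real.log (M * q ^ 5 * n ^ (3 * b))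
      ≤ (5 + Real.log M / Real.log 2) * (Real.log q + b * Real.log n) := by
  have hl2 : 0 < Real.log 2 := Real.log_pos (by norm_num)
  have hn0 : (0 : ℝ) < n := by positivity
  have hlq : 0 ≤ Real.log q := Real.log_nonneg hq
  have hlM : 0 ≤ Real.log M := Real.log_nonneg hM
  have hln : Real.log 2 ≤ Real.log n := Real.log_le_log (by norm_num) (by exact_mod_cast hn)
  have hb' : (1 : ℝ) ≤ b := by exact_mod_cast hb
  have hbn : Real.log 2 ≤ b * Real.log n := by nlinarith
  have h1 : Real.log M ≤ Real.log M / Real.log 2 * (Real.log q + b * Real.log n) := by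
    calc Real.log M = Real.log M / Real.log 2 * Real.log 2 := by field_simp
      _ ≤ _ := by
        gcongr
        linarith
  rw [Real.log_mul (by positivity) (by positivity), Real.log_mul (by positivity) (by positivity),
    Real.log_pow, Real.log_pow]
  push_cast
  nlinarith

/-- Both log-determinants when `ρ(A) ≤ 1 + c / n`. -/
lemma log_det_le_of_jordanDecomposition (h : IsSetting n k R σ δ) (hC₀ : 0 < C₀) (hC₁ : 0 < C₁)
    (hc : 0 < c) (hA : specRad A ≤ 1 + c / n) (D : JordanDecomposition A) {M : ℝ}
    (hM : M = ((4 * C₀) ^ 2 + 1) * (2 + 33 * C₁) * Real.exp c ^ 2) :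
    Real.log (gammaUpper₁ n A R σ δ * (gammaLower C₀ k A R σ)⁻¹).det
        ≤ m * Real.log (M * (d * condNum D.S / δ) ^ 5 * n ^ (3 * D.bMax)) ∧
      ∀ (Ω : Type u) [MeasurableSpace Ω] (P : Measure Ω) [IsProbabilityMeasure P]
        (η : ℕ → Ω → (Fin d → ℝ)), IsInnovation P σ η →
        Real.log (gammaUpper₂ P C₁ n A η R σ δ * (gammaLower C₀ k A R σ)⁻¹).det
          ≤ m * Real.log (M * (d * condNum D.S / δ) ^ 5 * n ^ (3 * D.bMax)) := by
  have := h.neZero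
  have hδ := h.delta_pos
  have hδ1 := h.delta_lt_one
  have hn : (1 : ℝ) ≤ n := by exact_mod_cast (by have := h.two_le; omega : 1 ≤ n)
  have hd : (1 : ℝ) ≤ d := by exact_mod_cast h.one_le_d
  have hcond := one_le_condNum D.isUnit_S
  set q := d * condNum D.S / δ with hqdef
  have hdc : d * condNum D.S ≤ q := by
    rw [hqdef, le_div_iff₀ hδ]
    exact mul_le_of_le_one_right (by positivity) hδ1.le
  have hdc1 : (d : ℝ) ≤ d * condNum D.S := le_mul_of_one_le_right (by positivity) hcond
  have hdq : d ≤ q := hdc1.trans hdc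
  have hq : 1 ≤ q := hd.trans hdq
  have hδq : 1 / δ ≤ q := by
    rw [hqdef]
    gcongr
    exact hd.trans hdc1
  set b := D.bMax with hbdef
  have hb : 1 ≤ b := D.one_le_bMax
  set B := q * (Real.exp c * n ^ b) with hB
  have hB0 : 0 ≤ B := by positivity
  have hAB : ∀ s ∈ Finset.range n, ‖A ^ s‖ ≤ B := fun s hs => by
    refine (D.norm_pow_le_of_lt hc hA (Finset.mem_range.mp hs)).trans ?_
    rw [hB]
    gcongr
  have hG : ∑ s ∈ Finset.range n, ‖A ^ s‖ ^ 2 ≤ n * B ^ 2 := by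
    calc _ ≤ ∑ _s ∈ Finset.range n, B ^ 2 :=
          Finset.sum_le_sum fun s hs => pow_le_pow_left₀ (norm_nonneg _) (hAB s hs) 2
      _ = _ := by simp
  have hH : ∑ s ∈ Finset.range n, ‖A ^ s‖ ≤ n * B := by
    calc _ ≤ ∑ _s ∈ Finset.range n, B := Finset.sum_le_sum hAB
      _ = _ := by simp
  have hexp : 1 ≤ Real.exp c := Real.one_le_exp hc.le
  have hM1 : 1 ≤ M := by
    rw [hM]
    refine one_le_mul_of_one_le_of_one_le (one_le_mul_of_one_le_of_one_le ?_ ?_)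
      (one_le_pow₀ hexp)
    · linarith [sq_nonneg (4 * C₀)]
    · linarith
  have hc1 : 1 ≤ M * q ^ 5 * n ^ (3 * b) :=
    one_le_mul_of_one_le_of_one_le (one_le_mul_of_one_le_of_one_le hM1 (one_le_pow₀ hq))
      (one_le_pow₀ hn)
  have hnB : n * B ^ 2 ≤ Real.exp c ^ 2 * q ^ 2 * n ^ (3 * b) := by
    calc n * B ^ 2 = Real.exp c ^ 2 * q ^ 2 * (n : ℝ) ^ (2 * b + 1) := by
          rw [hB]
          ring
      _ ≤ _ := by
          gcongr
          omega
  have hfin : ∀ x : ℝ, 0 ≤ x → x ≤ (2 + 33 * C₁) * q ^ 3 →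
      (4 * C₀) ^ 2 * (x * (n * B ^ 2)) ≤ M * q ^ 5 * n ^ (3 * b) := fun x hx0 hx => by
    calc (4 * C₀) ^ 2 * (x * (n * B ^ 2))
        ≤ ((4 * C₀) ^ 2 + 1) * ((2 + 33 * C₁) * q ^ 3
            * (Real.exp c ^ 2 * q ^ 2 * n ^ (3 * b))) := by
          gcongr
          linarith
      _ = _ := by
          rw [hM]
          ring
  have hq23 : q ^ 2 ≤ q ^ 3 := pow_le_pow_right₀ hq (by norm_num)
  have hq3 : 1 ≤ q ^ 3 := one_le_pow₀ hq
  refine ⟨log_det_gammaUpper₁_le h hC₀ hG hc1 (hfin _ (by positivity) ?_), fun Ω _ P _ η hη =>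
    log_det_gammaUpper₂_le h hη hC₀ hC₁ hG hH hc1 ?_⟩
  · calc (m : ℝ) / δ = m * (1 / δ) := by ring
      _ ≤ q ^ 2 * q := by
          have hmq : (m : ℝ) ≤ q ^ 2 := by
            calc (m : ℝ) ≤ (d : ℝ) ^ 2 := by exact_mod_cast h.le_sq
              _ ≤ q ^ 2 := by gcongr
          gcongr
      _ = 1 * q ^ 3 := by ring
      _ ≤ _ := by
          gcongr
          linarith
  · have hψ := h.psi_le hC₁ hq hdq hδq
    have hψ0 := h.psi_nonneg hC₁
    convert hfin (2 + 3 * psi C₁ m d δ) (by positivity) ?_ using 2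
    · field_simp
    · nlinarith

end GeneralCase

section StableCase

variable {n d m k : ℕ} {A : Matrix (Fin d) (Fin d) ℝ}

lemma sum_range_geometric_le {x : ℝ} (h0 : 0 ≤ x) (h1 : x < 1) (n : ℕ) :
    ∑ s ∈ Finset.range n, x ^ s ≤ (1 - x)⁻¹ := by
  rw [← tsum_geometric_of_lt_one h0 h1]
  exact (summable_geometric_of_lt_one h0 h1).sum_le_tsum _ fun s _ => pow_nonneg h0 s

lemma sum_norm_pow_sq_le_of_decayIndex [NeZero d] {r C : ℝ} (hr0 : 0 < r) (hr : r < 1)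
    (hA : specRad A ≤ r) (hC : ‖A‖ ≤ C) (n : ℕ) :
    ∑ s ∈ Finset.range n, ‖A ^ s‖ ^ 2 ≤ decayIndex r A * (1 + C) ^ (2 * decayIndex r A)
      + (1 - ((1 + r) / 2) ^ 2)⁻¹ := by
  set N := decayIndex r A with hN
  have hC1 : 1 ≤ 1 + C := by linarith [norm_nonneg A]
  have hpt : ∀ s, ‖A ^ s‖ ^ 2 ≤ (if s < N then (1 + C) ^ (2 * N) else 0)
      + (((1 + r) / 2) ^ 2) ^ s := fun s => by
    split_ifs with hs
    · have h1 : ‖A ^ s‖ ^ 2 ≤ (1 + C) ^ (2 * N) := by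
        calc ‖A ^ s‖ ^ 2 ≤ (‖A‖ ^ s) ^ 2 := by
              gcongr
              exact _root_.norm_pow_le A s
          _ ≤ ((1 + C) ^ s) ^ 2 := by
              gcongr
              linarith
          _ = (1 + C) ^ (2 * s) := by rw [← pow_mul, mul_comm]
          _ ≤ _ := pow_le_pow_right₀ hC1 (by omega)
      have : 0 ≤ (((1 + r) / 2) ^ 2) ^ s := by positivity
      linarith
    · have h1 := norm_pow_le_of_decayIndex_le hr hA (not_lt.mp hs)
      have h2 := pow_le_pow_left₀ (norm_nonneg _) h1 2
      rw [zero_add, ← pow_mul, mul_comm 2 s, pow_mul]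
      exact h2
  refine (Finset.sum_le_sum fun s _ => hpt s).trans ?_
  rw [Finset.sum_add_distrib]
  refine add_le_add ?_ (sum_range_geometric_le (sq_nonneg _) (by nlinarith) n)
  rw [← Finset.sum_filter, Finset.sum_const, nsmul_eq_mul]
  gcongr
  calc _ ≤ (Finset.range N).card := Finset.card_le_card fun s hs => by
        simpa using (Finset.mem_filter.mp hs).2
    _ = N := Finset.card_range N

lemma sum_norm_pow_sq_le_sq {H : ℝ} (hH : ∑ s ∈ Finset.range n, ‖A ^ s‖ ≤ H) :
    ∑ s ∈ Finset.range n, ‖A ^ s‖ ^ 2 ≤ H ^ 2 :=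
  (Finset.sum_sq_le_sq_sum_of_nonneg fun _ _ => norm_nonneg _).trans
    (pow_le_pow_left₀ (Finset.sum_nonneg fun _ _ => norm_nonneg _) hH 2)

lemma sum_norm_pow_le_of_geometric [NeZero d] {C ϱ : ℝ} (hC : 0 < C) (hϱ0 : 0 < ϱ) (hϱ : ϱ < 1)
    (hA : ∀ t : ℕ, 1 ≤ t → t ≤ n → specNorm (A ^ t) ≤ C * ϱ ^ t) :
    ∑ s ∈ Finset.range n, ‖A ^ s‖ ≤ (1 + C) * (1 - ϱ)⁻¹ := by
  calc ∑ s ∈ Finset.range n, ‖A ^ s‖ ≤ ∑ s ∈ Finset.range n, (1 + C) * ϱ ^ s := by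
        refine Finset.sum_le_sum fun s hs => ?_
        rcases Nat.eq_zero_or_pos s with rfl | hs0
        · simp [hC.le]
        · refine (hA s hs0 (Finset.mem_range.mp hs).le).trans ?_
          gcongr
          linarith
    _ = (1 + C) * ∑ s ∈ Finset.range n, ϱ ^ s := by rw [Finset.mul_sum]
    _ ≤ _ := by
        have := sum_range_geometric_le hϱ0.le hϱ n
        gcongr

lemma IsSetting.psi_div_le {R : Matrix (Fin d × Fin d) (Fin m) ℝ} {σ δ C₁ c : ℝ}
    (h : IsSetting n k R σ δ) (hC₁ : 0 < C₁) (hc : 0 < c)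
    (hn : c * (m + Real.log (d / δ)) ≤ n) : psi C₁ m d δ / n ≤ C₁ * (8 / c + 1) := by
  have hδ := h.delta_pos
  have hd : (1 : ℝ) ≤ d := by exact_mod_cast h.one_le_d
  have hn1 : (1 : ℝ) ≤ n := by exact_mod_cast (by have := h.two_le; omega : 1 ≤ n)
  have hlog : Real.log d + Real.log (2 / δ) = Real.log 2 + Real.log (d / δ) := by
    rw [Real.log_div (by norm_num) hδ.ne', Real.log_div (by positivity) hδ.ne']
    ring
  have hdδ : 0 ≤ Real.log (d / δ) := Real.log_nonneg (by
    rw [le_div_iff₀ hδ]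
    linarith [h.delta_lt_one])
  have h2 : Real.log 2 ≤ 1 := (Real.log_le_sub_one_of_pos (by norm_num)).trans (by norm_num)
  have hm : (m : ℝ) * Real.log 9 ≤ m * 8 := by
    have := log_nine_le
    gcongr
  have h3 : m + Real.log (d / δ) ≤ n / c := by rwa [le_div_iff₀ hc, mul_comm]
  rw [div_le_iff₀ (by positivity), psi, mul_assoc]
  gcongr
  calc _ ≤ 8 * (m + Real.log (d / δ)) + 1 := by linarith
    _ ≤ 8 * (n / c) + n := by linarith
    _ = _ := by ring

end StableCase

end LinearVAR

theorem proposition2 :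
    -- the general case: `ρ(A) ≤ 1 + c / n`, both upper matrices, every Jordan decomposition of `A`
    (∀ C₀ C₁ c : ℝ, 0 < C₀ → 0 < C₁ → 0 < c → ∃ K : ℝ, 0 < K ∧
      ∀ (n d m k : ℕ) (A : Matrix (Fin d) (Fin d) ℝ) (R : Matrix (Fin d × Fin d) (Fin m) ℝ)
        (σ δ : ℝ), LinearVAR.IsSetting n k R σ δ →
        LinearVAR.specRad A ≤ 1 + c / n →
        ∀ D : LinearVAR.JordanDecomposition A,
          Real.log (LinearVAR.gammaUpper₁ n A R σ δ
              * (LinearVAR.gammaLower C₀ k A R σ)⁻¹).det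
            ≤ K * (m * (Real.log (d * LinearVAR.condNum D.S / δ) + D.bMax * Real.log n)) ∧
          ∀ (Ω : Type u) [MeasurableSpace Ω] (P : Measure Ω) [IsProbabilityMeasure P]
            (η : ℕ → Ω → (Fin d → ℝ)), LinearVAR.IsInnovation P σ η →
            Real.log (LinearVAR.gammaUpper₂ P C₁ n A η R σ δ
                * (LinearVAR.gammaLower C₀ k A R σ)⁻¹).det
              ≤ K * (m * (Real.log (d * LinearVAR.condNum D.S / δ) + D.bMax * Real.log n))) ∧
    -- the stable case: `ρ(A) ≤ r < 1` and `‖A‖₂ ≤ C`, first upper matrix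
    (∀ C₀ r C τ : ℝ, 0 < C₀ → 0 < r → r < 1 → 0 < C → 1 < τ → ∃ K : ℕ → ℝ, (∀ N, 0 < K N) ∧
      ∀ (n d m k : ℕ) (A : Matrix (Fin d) (Fin d) ℝ) (R : Matrix (Fin d × Fin d) (Fin m) ℝ)
        (σ δ : ℝ), LinearVAR.IsSetting n k R σ δ → τ ≤ m / δ →
        LinearVAR.specRad A ≤ r → LinearVAR.specNorm A ≤ C →
          Real.log (LinearVAR.gammaUpper₁ n A R σ δ
              * (LinearVAR.gammaLower C₀ k A R σ)⁻¹).det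
            ≤ K (LinearVAR.decayIndex r A) * (m * Real.log (m / δ))) ∧
    -- the strongly stable case, second upper matrix
    (∀ C₀ C₁ r μ₁ C ϱ c : ℝ, 0 < C₀ → 0 < C₁ → 0 < r → r < 1 → 0 < μ₁ → 0 < C →
      0 < ϱ → ϱ < 1 → 0 < c → ∃ K : ℝ, 0 < K ∧
      ∀ (n d m k : ℕ) (A : Matrix (Fin d) (Fin d) ℝ) (R : Matrix (Fin d × Fin d) (Fin m) ℝ)
        (σ δ : ℝ), LinearVAR.IsSetting n k R σ δ →
        LinearVAR.specRad A ≤ r → μ₁ ≤ LinearVAR.muMin A →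
        (∀ t : ℕ, 1 ≤ t → t ≤ n → LinearVAR.specNorm (A ^ t) ≤ C * ϱ ^ t) →
        c * (m + Real.log (d / δ)) ≤ n →
        ∀ (Ω : Type u) [MeasurableSpace Ω] (P : Measure Ω) [IsProbabilityMeasure P]
          (η : ℕ → Ω → (Fin d → ℝ)), LinearVAR.IsInnovation P σ η →
          Real.log (LinearVAR.gammaUpper₂ P C₁ n A η R σ δ
              * (LinearVAR.gammaLower C₀ k A R σ)⁻¹).det
            ≤ K * m) := by
  refine ⟨fun C₀ C₁ c hC₀ hC₁ hc => ?_, fun C₀ r C τ hC₀ hr0 hr hC hτ => ?_,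
    fun C₀ C₁ r μ₁ C ϱ c hC₀ hC₁ _ _ _ hC hϱ0 hϱ hc => ?_⟩
  · set M := ((4 * C₀) ^ 2 + 1) * (2 + 33 * C₁) * Real.exp c ^ 2 with hM
    have hM1 : 1 ≤ M := by
      refine one_le_mul_of_one_le_of_one_le (one_le_mul_of_one_le_of_one_le ?_ ?_)
        (one_le_pow₀ (Real.one_le_exp hc.le))
      · linarith [sq_nonneg (4 * C₀)]
      · linarith
    have hK : 0 < 5 + Real.log M / Real.log 2 := by
      have h1 := Real.log_nonneg hM1
      have h2 : 0 < Real.log 2 := Real.log_pos (by norm_num)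
      positivity
    refine ⟨_, hK, fun n d m k A R σ δ h hA D => ?_⟩
    have := h.neZero
    have hq : 1 ≤ d * LinearVAR.condNum D.S / δ := by
      rw [le_div_iff₀ h.delta_pos, one_mul]
      exact h.delta_lt_one.le.trans (one_le_mul_of_one_le_of_one_le
        (by exact_mod_cast h.one_le_d) (LinearVAR.one_le_condNum D.isUnit_S))
    have hle := mul_le_mul_of_nonneg_left
      (LinearVAR.log_mul_pow_mul_pow_le hM1 hq h.two_le D.one_le_bMax) (Nat.cast_nonneg (α := ℝ) m)
    rw [mul_left_comm] at hle
    obtain ⟨h1, h2⟩ := LinearVAR.log_det_le_of_jordanDecomposition h hC₀ hC₁ hc hA D hM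
    exact ⟨h1.trans hle, fun Ω _ P _ η hη => (h2 Ω P η hη).trans hle⟩
  · set g : ℕ → ℝ := fun N => N * (1 + C) ^ (2 * N) + (1 - ((1 + r) / 2) ^ 2)⁻¹ with hg
    set M : ℕ → ℝ := fun N => ((4 * C₀) ^ 2 + 1) * g N with hM
    have hg1 : ∀ N, 1 ≤ g N := fun N => by
      have h1 : (1 : ℝ) ≤ (1 - ((1 + r) / 2) ^ 2)⁻¹ :=
        (one_le_inv₀ (by nlinarith)).mpr (by nlinarith)
      have h2 : (0 : ℝ) ≤ N * (1 + C) ^ (2 * N) := by positivity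
      simp only [hg]
      linarith
    have hM1 : ∀ N, 1 ≤ M N := fun N =>
      one_le_mul_of_one_le_of_one_le (by linarith [sq_nonneg (4 * C₀)]) (hg1 N)
    have hlogτ : 0 < Real.log τ := Real.log_pos hτ
    refine ⟨fun N => 1 + Real.log (M N) / Real.log τ, fun N => ?_,
      fun n d m k A R σ δ h hτm hA hAC => ?_⟩
    · have := Real.log_nonneg (hM1 N)
      positivity
    · have := h.neZero
      set N := LinearVAR.decayIndex r A with hN
      have hmδ : 1 ≤ m / δ := hτ.le.trans hτm
      have hgN : 0 ≤ g N := zero_le_one.trans (hg1 N)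
      have hMN : 0 < M N := zero_lt_one.trans_le (hM1 N)
      refine (LinearVAR.log_det_gammaUpper₁_le h hC₀ (c := M N * (m / δ))
        (LinearVAR.sum_norm_pow_sq_le_of_decayIndex hr0 hr hA hAC n)
        (one_le_mul_of_one_le_of_one_le (hM1 N) hmδ) ?_).trans ?_
      · calc (4 * C₀) ^ 2 * (m / δ * g N) ≤ ((4 * C₀) ^ 2 + 1) * (m / δ * g N) := by
              gcongr
              linarith
          _ = _ := by
              simp only [hM]
              ring
      · rw [mul_left_comm, Real.log_mul hMN.ne' (by positivity)]
        have hlog : Real.log τ ≤ Real.log (m / δ) := Real.log_le_log (by positivity) hτm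
        have hlM := Real.log_nonneg (hM1 N)
        have h1 : Real.log (M N) ≤ Real.log (M N) / Real.log τ * Real.log (m / δ) := by
          calc Real.log (M N) = Real.log (M N) / Real.log τ * Real.log τ := by field_simp
            _ ≤ _ := by gcongr
        gcongr
        linarith
  · set H := (1 + C) * (1 - ϱ)⁻¹ with hH
    have hH1 : 1 ≤ H := one_le_mul_of_one_le_of_one_le (by linarith)
      ((one_le_inv₀ (by linarith)).mpr (by linarith))
    set M := ((4 * C₀) ^ 2 + 1) * (H ^ 2 * (2 + 3 * (C₁ * (8 / c + 1)))) with hM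
    have hM1 : 1 ≤ M := by
      refine one_le_mul_of_one_le_of_one_le (by linarith [sq_nonneg (4 * C₀)])
        (one_le_mul_of_one_le_of_one_le (one_le_pow₀ hH1) ?_)
      have : 0 ≤ 3 * (C₁ * (8 / c + 1)) := by positivity
      linarith
    have hlM := Real.log_nonneg hM1
    refine ⟨Real.log M + 1, by positivity, fun n d m k A R σ δ h _ _ hA hn Ω _ P _ η hη => ?_⟩
    have := h.neZero
    have hsum := LinearVAR.sum_norm_pow_le_of_geometric hC hϱ0 hϱ hA
    refine (LinearVAR.log_det_gammaUpper₂_le h hη hC₀ hC₁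
      (LinearVAR.sum_norm_pow_sq_le_sq hsum) hsum hM1 ?_).trans ?_
    · have hψ := h.psi_div_le hC₁ hc hn
      have hψ0 := h.psi_nonneg hC₁
      calc _ = (4 * C₀) ^ 2 * (H ^ 2 * (2 + 3 * (LinearVAR.psi C₁ m d δ / n))) := by ring
        _ ≤ ((4 * C₀) ^ 2 + 1) * (H ^ 2 * (2 + 3 * (C₁ * (8 / c + 1)))) := by
            gcongr
            linarith
    · rw [mul_comm]
      gcongr
      linarith
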